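/- Work in the language $\{\wedge,\vee,\cdot,\to,0,1\}$ with countably many variables and $\neg\varphi:=\varphi\to 0$. Let $\mathbf{FL_e}$ be the external logic of the Full Lambek calculus with exchange ($\Phi\vdash\psi$ iff the sequent $\Rightarrow\psi$ is derivable from the sequents $\Rightarrow\varphi$, $\varphi\in\Phi$). A substructural logic is an axiomatic extension of $\mathbf{FL_e}$; these form a complete lattice under inclusion. $\mathbf{FL_{ew}}$ is $\mathbf{FL_e}$ with weakening (axioms $p\to 1$ and $0\to p$), $\mathbf{IPL}$ is intuitionistic logic ($\mathbf{FL_{ew}}$ plus $(p\wedge q)\to(p\cdot q)$), and $\mathbf{CPL}$ is classical logic ($\mathbf{IPL}$ plus $\neg\neg p\to p$). A substructural logic $\mathbf K$ has the Glivenko property relative to $\mathbf{L}$ if, for all $\varphi$, $\vdash_{\mathbf L}\varphi$ iff $\vdash_{\mathbf K}\neg\neg\varphi$; $\mathbf G_{\mathbf{FL_e}}(\mathbf{CPL})$ is the infimum of all substructural logics with the Glivenko property relative to $\mathbf{CPL}$, and $\mathbf G_{\mathbf{FL_{ew}}}(\mathbf{CPL}):=\mathbf G_{\mathbf{FL_e}}(\mathbf{CPL})\vee\mathbf{FL_{ew}}$.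 For a substructural logic $\mathbf L$ let $\mathsf V(\mathbf L)$ be the variety of $\mathrm{FL_e}$-algebras (commutative residuated lattices with an arbitrary constant $0$) satisfying $1\le\varphi$ for every theorem $\varphi$ of $\mathbf L$. For a term-definable binary connective $\Rightarrow$, $(\mathbf L,\Rightarrow)$ is connexive if every algebra in $\mathsf V(\mathbf L)$ satisfies $$1\le\neg(x\Rightarrow\neg x),\quad 1\le\neg(\neg x\Rightarrow x),\quad 1\le(x\Rightarrow y)\Rightarrow\neg(x\Rightarrow\neg y),\quad 1\le(x\Rightarrow\neg y)\Rightarrow\neg(x\Rightarrow y),$$ and some algebra in $\mathsf V(\mathbf L)$ has elements $x,y$ with $x\Rightarrow y\ne y\Rightarrow x$. Put $$x\Rightarrow_\wedge y:=(x\to y)\wedge(y\to\neg\neg x),\qquad x\Rightarrow_\circ y:=(x\to y)\cdot(y\to\neg\neg x).$$ Theorem. The logic $\mathbf G_{\mathbf{FL_{ew}}}(\mathbf{CPL})$ is the least extension of $\mathbf{FL_{ew}}$ among substructural logics that has the Glivenko property relative to $\mathbf{CPL}$, and it is $\mathbf{FL_{ew}}$ plus the pseudo-complementation axiom $(p\wedge\neg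 p)\to 0$. Moreover, for every substructural logic $\mathbf L$ with $\mathbf{FL_{ew}}\subseteq\mathbf L\subseteq\mathbf{IPL}$ and each ${\Rightarrow}\in\{\Rightarrow_\circ,\Rightarrow_\wedge\}$, the following are equivalent: 1. $(\mathbf L,\Rightarrow)$ is connexive. 2. Aristotle's thesis $\neg(\varphi\Rightarrow\neg\varphi)$ is a theorem of $\mathbf L$ for every formula $\varphi$. 3. Aristotle's thesis $\neg(\neg\varphi\Rightarrow\varphi)$ is a theorem of $\mathbf L$ for every formula $\varphi$. 4. $\mathbf L$ is an axiomatic extension of $\mathbf G_{\mathbf{FL_{ew}}}(\mathbf{CPL})$. (In particular, having at least one of Aristotle's theses is equivalent to the other conditions.) -/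

import Mathlib

universe u v w

namespace CnxLogic

/-! ## The algebraic language of FLe-algebras -/

/-- Terms (formulas) over the language `{∧, ∨, ·, →, 0, 1}` with variables from `V`. -/
inductive Term (V : Type v) : Type v
  | var : V → Term V
  | meet : Term V → Term V → Term V
  | join : Term V → Term V → Term V
  | fusion : Term V → Term V → Term V
  | imp : Term V → Term V → Term V
  | zero : Term V
  | one : Term V

namespace Term

variable {V : Type v} {W : Type w}

/-- `¬ φ := φ → 0`. -/
def neg (φ : Term V) : Term V := φ.imp zero

/-- Simultaneous substitution of terms for variables. -/
def subst (σ : V → Term W) : Term V → Term W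
  | var n => σ n
  | meet φ ψ => meet (φ.subst σ) (ψ.subst σ)
  | join φ ψ => join (φ.subst σ) (ψ.subst σ)
  | fusion φ ψ => fusion (φ.subst σ) (ψ.subst σ)
  | imp φ ψ => imp (φ.subst σ) (ψ.subst σ)
  | zero => zero
  | one => one

theorem subst_subst {X : Type*} (σ : V → Term W) (τ : W → Term X) (φ : Term V) :
    (φ.subst σ).subst τ = φ.subst (fun n => (σ n).subst τ) := by
  induction φ <;> simp_all [subst]

theorem subst_var (φ : Term V) : φ.subst var = φ := by
  induction φ <;> simp_all [subst]

end Term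

/-- Formulas: terms over a countably infinite set of propositional variables. -/
abbrev Fm : Type := Term ℕ

/-! ## Logics as structural consequence relations -/

/-- A logic: a structural consequence relation on formulas. -/
@[ext]
structure Logic where
  Deriv : Set Fm → Fm → Prop
  refl : ∀ (Γ : Set Fm) (φ : Fm), φ ∈ Γ → Deriv Γ φ
  mono : ∀ (Γ Δ : Set Fm) (φ : Fm), Γ ⊆ Δ → Deriv Γ φ → Deriv Δ φ
  trans : ∀ (Γ Δ : Set Fm) (φ : Fm), (∀ ψ ∈ Δ, Deriv Γ ψ) → Deriv Δ φ → Deriv Γ φ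
  structural : ∀ (σ : ℕ → Fm) (Γ : Set Fm) (φ : Fm),
    Deriv Γ φ → Deriv (Term.subst σ '' Γ) (φ.subst σ)

namespace Logic

/-- Logics are ordered by inclusion of consequence relations. -/
instance : PartialOrder Logic where
  le L M := ∀ Γ φ, L.Deriv Γ φ → M.Deriv Γ φ
  le_refl _ _ _ h := h
  le_trans _ _ _ h₁ h₂ Γ φ h := h₂ Γ φ (h₁ Γ φ h)
  le_antisymm L M h₁ h₂ := by
    ext Γ φ
    exact ⟨h₁ Γ φ, h₂ Γ φ⟩

/-- `φ` is a theorem of `L`. -/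
def Thm (L : Logic) (φ : Fm) : Prop := L.Deriv ∅ φ

/-- All substitution instances of the formulas in `Ax`. -/
def instances (Ax : Set Fm) : Set Fm := {φ | ∃ α ∈ Ax, ∃ σ : ℕ → Fm, φ = α.subst σ}

theorem subset_instances (Ax : Set Fm) : Ax ⊆ instances Ax :=
  fun α hα => ⟨α, hα, Term.var, (Term.subst_var α).symm⟩

/-- The extension of `M` by the axiom schemes `Ax`. -/
def extend (M : Logic) (Ax : Set Fm) : Logic where
  Deriv Γ φ := M.Deriv (Γ ∪ instances Ax) φ
  refl Γ φ h := M.refl _ _ (Or.inl h)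
  mono Γ Δ φ h := M.mono _ _ _ (Set.union_subset_union_left _ h)
  trans Γ Δ φ h₁ h₂ := by
    refine M.trans _ _ _ ?_ h₂
    rintro ψ (hψ | hψ)
    · exact h₁ ψ hψ
    · exact M.refl _ _ (Or.inr hψ)
  structural σ Γ φ h := by
    refine M.mono _ _ _ ?_ (M.structural σ _ _ h)
    rintro _ ⟨ψ, hψ | ⟨α, hα, τ, rfl⟩, rfl⟩
    · exact Or.inl ⟨ψ, hψ, rfl⟩
    · exact Or.inr ⟨α, hα, _, Term.subst_subst τ σ α⟩

/-- `L` is an axiomatic extension of `M`. -/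
def IsAxiomaticExtension (L M : Logic) : Prop := ∃ Ax : Set Fm, L = M.extend Ax

end Logic

/-! ## The calculus FLe and its external logic -/

/-- Derivability, from a set `S` of sequents, in the Full Lambek calculus with exchange. A sequent
is a finite multiset of formulas (so exchange is built in) together with at most one formula. -/
inductive SeqDeriv (S : Set (Multiset Fm × Option Fm)) : Multiset Fm → Option Fm → Prop
  | assumption {Γ : Multiset Fm} {δ : Option Fm} : (Γ, δ) ∈ S → SeqDeriv S Γ δ
  | id (φ : Fm) : SeqDeriv S {φ} (some φ)
  | cut {Γ Δ : Multiset Fm} {φ : Fm} {δ : Option Fm} :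
      SeqDeriv S Γ (some φ) → SeqDeriv S (φ ::ₘ Δ) δ → SeqDeriv S (Γ + Δ) δ
  | one_left {Γ : Multiset Fm} {δ : Option Fm} :
      SeqDeriv S Γ δ → SeqDeriv S (Term.one ::ₘ Γ) δ
  | one_right : SeqDeriv S 0 (some Term.one)
  | zero_left : SeqDeriv S {Term.zero} none
  | zero_right {Γ : Multiset Fm} : SeqDeriv S Γ none → SeqDeriv S Γ (some Term.zero)
  | meet_left₁ {Γ : Multiset Fm} {φ ψ : Fm} {δ : Option Fm} :
      SeqDeriv S (φ ::ₘ Γ) δ → SeqDeriv S (φ.meet ψ ::ₘ Γ) δ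
  | meet_left₂ {Γ : Multiset Fm} {φ ψ : Fm} {δ : Option Fm} :
      SeqDeriv S (ψ ::ₘ Γ) δ → SeqDeriv S (φ.meet ψ ::ₘ Γ) δ
  | meet_right {Γ : Multiset Fm} {φ ψ : Fm} :
      SeqDeriv S Γ (some φ) → SeqDeriv S Γ (some ψ) → SeqDeriv S Γ (some (φ.meet ψ))
  | join_left {Γ : Multiset Fm} {φ ψ : Fm} {δ : Option Fm} :
      SeqDeriv S (φ ::ₘ Γ) δ → SeqDeriv S (ψ ::ₘ Γ) δ → SeqDeriv S (φ.join ψ ::ₘ Γ) δ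
  | join_right₁ {Γ : Multiset Fm} {φ ψ : Fm} :
      SeqDeriv S Γ (some φ) → SeqDeriv S Γ (some (φ.join ψ))
  | join_right₂ {Γ : Multiset Fm} {φ ψ : Fm} :
      SeqDeriv S Γ (some ψ) → SeqDeriv S Γ (some (φ.join ψ))
  | fusion_left {Γ : Multiset Fm} {φ ψ : Fm} {δ : Option Fm} :
      SeqDeriv S (φ ::ₘ ψ ::ₘ Γ) δ → SeqDeriv S (φ.fusion ψ ::ₘ Γ) δ
  | fusion_right {Γ Δ : Multiset Fm} {φ ψ : Fm} :
      SeqDeriv S Γ (some φ) → SeqDeriv S Δ (some ψ) → SeqDeriv S (Γ + Δ) (some (φ.fusion ψ))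
  | imp_left {Γ Δ : Multiset Fm} {φ ψ : Fm} {δ : Option Fm} :
      SeqDeriv S Γ (some φ) → SeqDeriv S (ψ ::ₘ Δ) δ → SeqDeriv S (φ.imp ψ ::ₘ (Γ + Δ)) δ
  | imp_right {Γ : Multiset Fm} {φ ψ : Fm} :
      SeqDeriv S (φ ::ₘ Γ) (some ψ) → SeqDeriv S Γ (some (φ.imp ψ))

/-- The sequents `⇒ φ` for `φ ∈ Φ`. -/
def asserted (Φ : Set Fm) : Set (Multiset Fm × Option Fm) := (fun φ => (0, some φ)) '' Φ

namespace SeqDeriv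

theorem replace {S T : Set (Multiset Fm × Option Fm)}
    (hS : ∀ Γ δ, (Γ, δ) ∈ S → SeqDeriv T Γ δ) {Γ : Multiset Fm} {δ : Option Fm}
    (h : SeqDeriv S Γ δ) : SeqDeriv T Γ δ := by
  induction h with
  | assumption h => exact hS _ _ h
  | id φ => exact .id φ
  | cut _ _ h₁ h₂ => exact .cut h₁ h₂
  | one_left _ h => exact .one_left h
  | one_right => exact .one_right
  | zero_left => exact .zero_left
  | zero_right _ h => exact .zero_right h
  | meet_left₁ _ h => exact .meet_left₁ h
  | meet_left₂ _ h => exact .meet_left₂ h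
  | meet_right _ _ h₁ h₂ => exact .meet_right h₁ h₂
  | join_left _ _ h₁ h₂ => exact .join_left h₁ h₂
  | join_right₁ _ h => exact .join_right₁ h
  | join_right₂ _ h => exact .join_right₂ h
  | fusion_left _ h => exact .fusion_left h
  | fusion_right _ _ h₁ h₂ => exact .fusion_right h₁ h₂
  | imp_left _ _ h₁ h₂ => exact .imp_left h₁ h₂
  | imp_right _ h => exact .imp_right h

theorem subst {Φ : Set Fm} (σ : ℕ → Fm) {Γ : Multiset Fm} {δ : Option Fm}
    (h : SeqDeriv (asserted Φ) Γ δ) :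
    SeqDeriv (asserted (Term.subst σ '' Φ)) (Γ.map (Term.subst σ)) (δ.map (Term.subst σ)) := by
  induction h with
  | assumption h =>
    obtain ⟨φ, hφ, h⟩ := h
    obtain ⟨rfl, rfl⟩ := Prod.mk.inj h
    exact .assumption ⟨φ.subst σ, ⟨φ, hφ, rfl⟩, rfl⟩
  | id φ => simpa using SeqDeriv.id (φ.subst σ)
  | cut _ _ h₁ h₂ => simpa using SeqDeriv.cut h₁ (by simpa using h₂)
  | one_left _ h => simpa [Term.subst] using SeqDeriv.one_left h
  | one_right => exact .one_right
  | zero_left => exact .zero_left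
  | zero_right _ h => exact .zero_right h
  | meet_left₁ _ h =>
    simpa [Term.subst] using SeqDeriv.meet_left₁ (by simpa using h)
  | meet_left₂ _ h =>
    simpa [Term.subst] using SeqDeriv.meet_left₂ (by simpa using h)
  | meet_right _ _ h₁ h₂ => exact .meet_right h₁ h₂
  | join_left _ _ h₁ h₂ =>
    simpa [Term.subst] using SeqDeriv.join_left (by simpa using h₁) (by simpa using h₂)
  | join_right₁ _ h => exact .join_right₁ h
  | join_right₂ _ h => exact .join_right₂ h
  | fusion_left _ h =>
    simpa [Term.subst] using SeqDeriv.fusion_left (by simpa using h)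
  | fusion_right _ _ h₁ h₂ =>
    simpa [Term.subst] using SeqDeriv.fusion_right h₁ h₂
  | imp_left _ _ h₁ h₂ =>
    simpa [Term.subst] using SeqDeriv.imp_left h₁ (by simpa using h₂)
  | imp_right _ h => exact .imp_right (by simpa using h)

end SeqDeriv

/-- The external logic of the calculus: `Φ ⊢ ψ` iff the sequent `⇒ ψ` is derivable from the
sequents `⇒ φ`, `φ ∈ Φ`. -/
def FLeLogic : Logic where
  Deriv Φ ψ := SeqDeriv (asserted Φ) 0 (some ψ)
  refl Φ φ h := .assumption ⟨φ, h, rfl⟩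
  mono Φ Ψ φ h hd := hd.replace fun _ _ hs => .assumption (Set.image_mono h hs)
  trans Φ Ψ φ h hd := hd.replace fun _ _ hs => by
    obtain ⟨ψ, hψ, hs⟩ := hs
    obtain ⟨rfl, rfl⟩ := Prod.mk.inj hs
    exact h ψ hψ
  structural σ Φ φ h := by simpa using h.subst σ

/-! ## The lattice of substructural logics -/

/-- Substructural logics: the axiomatic extensions of the external logic of FLe. -/
abbrev SubstructuralLogic : Type := {L : Logic // L.IsAxiomaticExtension FLeLogic}

namespace SubstructuralLogic

/-- The external logic of FLe, as a substructural logic. -/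
def FLe : SubstructuralLogic :=
  ⟨FLeLogic, ∅, by ext Γ φ; simp [Logic.extend, Logic.instances]⟩

/-- The extension of the substructural logic `K` by the axiom schemes `Ax`. -/
def extend (K : SubstructuralLogic) (Ax : Set Fm) : SubstructuralLogic :=
  ⟨K.1.extend Ax, by
    obtain ⟨_, B, rfl⟩ := K
    refine ⟨B ∪ Ax, ?_⟩
    ext Γ φ
    have : Logic.instances (B ∪ Ax) = Logic.instances B ∪ Logic.instances Ax := by
      ext χ
      simp only [Logic.instances, Set.mem_union, Set.mem_ofPred_eq, or_and_right, exists_or]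
    simp only [Logic.extend, this]
    rw [Set.union_assoc, Set.union_comm (Logic.instances Ax)]⟩

/-- The join of a set of substructural logics: FLe together with all theorems of the members. -/
instance : SupSet SubstructuralLogic :=
  ⟨fun S => FLe.extend {φ | ∃ K ∈ S, K.1.Thm φ}⟩

theorem isLUB_sSup (S : Set SubstructuralLogic) : IsLUB S (sSup S) := by
  constructor
  · rintro ⟨_, B, rfl⟩ hK Γ φ h
    refine FLeLogic.mono _ _ _ (Set.union_subset_union_right _ ?_) h
    intro ψ hψ
    exact Logic.subset_instances _ ⟨_, hK, FLeLogic.refl _ _ (Or.inr hψ)⟩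
  · rintro ⟨_, B, rfl⟩ hM Γ φ h
    refine (FLeLogic.extend B).trans Γ (Γ ∪ Logic.instances {φ | ∃ K ∈ S, K.1.Thm φ}) φ ?_
      (FLeLogic.mono _ _ _ Set.subset_union_left h)
    rintro ψ (hψ | ⟨α, ⟨K, hK, hα⟩, σ, rfl⟩)
    · exact Logic.refl _ _ _ hψ
    · refine Logic.mono _ ∅ Γ _ (Set.empty_subset _) ?_
      have h₁ := (FLeLogic.extend B).structural σ _ _ (hM hK ∅ α hα)
      rwa [Set.image_empty] at h₁

/-- Substructural logics form a complete lattice under inclusion. -/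
instance : CompleteLattice SubstructuralLogic := completeLatticeOfSup _ isLUB_sSup

/-- `FLew`: FLe with weakening, i.e. with the axioms `p → 1` and `0 → p`. -/
def FLew : SubstructuralLogic :=
  FLe.extend {(Term.var 0).imp .one, Term.zero.imp (.var 0)}

/-- Intuitionistic logic in this language: FLew with `·` collapsed to `∧`
(the implication `p · q → p ∧ q` already holds in FLew). -/
def IPL : SubstructuralLogic :=
  FLew.extend {((Term.var 0).meet (.var 1)).imp ((Term.var 0).fusion (.var 1))}

/-- Classical logic: intuitionistic logic with double negation elimination. -/
def CPL : SubstructuralLogic :=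
  IPL.extend {(Term.var 0).neg.neg.imp (.var 0)}

/-- The Glivenko property holds for `K` relative to `L`. -/
def HasGlivenkoProperty (K L : SubstructuralLogic) : Prop :=
  ∀ φ : Fm, L.1.Thm φ ↔ K.1.Thm φ.neg.neg

/-- The least substructural logic with the Glivenko property relative to `L`, taken as the
infimum of all of them. -/
def glivenkoFLe (L : SubstructuralLogic) : SubstructuralLogic :=
  sInf {K | K.HasGlivenkoProperty L}

/-- The Glivenko logic of `K` relative to `L`. -/
def glivenko (K L : SubstructuralLogic) : SubstructuralLogic := glivenkoFLe L ⊔ K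

end SubstructuralLogic

/-! ## FLe-algebras -/

/-- FLe-algebras: commutative residuated lattices with an arbitrary constant `0`;
the residual is written `⇨`. -/
class FLeAlgebra (A : Type u) extends Lattice A, CommMonoid A, HImp A, Zero A where
  residuation : ∀ x y z : A, x * y ≤ z ↔ x ≤ y ⇨ z

/-- `¬ x := x → 0` in an FLe-algebra. -/
def FLeAlgebra.neg {A : Type u} [FLeAlgebra A] (x : A) : A := x ⇨ 0

/-- The value of a term under an assignment. -/
def Term.eval {V : Type v} {A : Type u} [FLeAlgebra A] (e : V → A) : Term V → A
  | var n => e n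
  | meet φ ψ => φ.eval e ⊓ ψ.eval e
  | join φ ψ => φ.eval e ⊔ ψ.eval e
  | fusion φ ψ => φ.eval e * ψ.eval e
  | imp φ ψ => φ.eval e ⇨ ψ.eval e
  | zero => 0
  | one => 1

/-- `A` belongs to the variety `V(L)`: it satisfies `1 ≤ φ` for every theorem `φ` of `L`. -/
def InVariety (L : Logic) (A : Type u) [FLeAlgebra A] : Prop :=
  ∀ φ : Fm, L.Thm φ → ∀ e : ℕ → A, 1 ≤ φ.eval e

/-! ## Connexivity -/

/-- Aristotle's and Boethius' theses for an operation `r` on an FLe-algebra. -/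
structure IsProtoConnexiveOp {A : Type u} [FLeAlgebra A] (r : A → A → A) : Prop where
  at₁ : ∀ x : A, 1 ≤ FLeAlgebra.neg (r x (FLeAlgebra.neg x))
  at₂ : ∀ x : A, 1 ≤ FLeAlgebra.neg (r (FLeAlgebra.neg x) x)
  bt₁ : ∀ x y : A, 1 ≤ r (r x y) (FLeAlgebra.neg (r x (FLeAlgebra.neg y)))
  bt₂ : ∀ x y : A, 1 ≤ r (r x (FLeAlgebra.neg y)) (FLeAlgebra.neg (r x y))

/-- Proto-connexive and not symmetric. -/
structure IsConnexiveOp {A : Type u} [FLeAlgebra A] (r : A → A → A) : Prop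
    extends IsProtoConnexiveOp r where
  nonsymm : ∃ x y : A, ¬ r x y ≤ r y x ∨ ¬ r y x ≤ r x y

/-- Term-definable binary connectives: terms in two variables. -/
abbrev BinTerm : Type := Term (Fin 2)

namespace BinTerm

/-- The formula obtained by applying the connective to two formulas. -/
def app (t : BinTerm) (φ ψ : Fm) : Fm := t.subst ![φ, ψ]

/-- The term operation of the connective on an FLe-algebra. -/
def op (t : BinTerm) {A : Type u} [FLeAlgebra A] (x y : A) : A := t.eval ![x, y]

/-- `x ⇒∧ y := (x → y) ∧ (y → ¬¬x)`. -/
def cnxMeet : BinTerm :=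
  ((Term.var 0).imp (.var 1)).meet ((Term.var 1).imp (Term.var 0).neg.neg)

/-- `x ⇒∘ y := (x → y) · (y → ¬¬x)`. -/
def cnxFusion : BinTerm :=
  ((Term.var 0).imp (.var 1)).fusion ((Term.var 1).imp (Term.var 0).neg.neg)

end BinTerm

/-- `(L, ⇒)` is connexive: the term operation is proto-connexive on every algebra of `V(L)` and
connexive on at least one of them. -/
def IsConnexive (L : SubstructuralLogic) (t : BinTerm) : Prop :=
  (∀ (A : Type u) [FLeAlgebra A], InVariety L.1 A → IsProtoConnexiveOp (t.op (A := A))) ∧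
  ∃ (A : Type u) (_ : FLeAlgebra A), InVariety L.1 A ∧ IsConnexiveOp (t.op (A := A))

end CnxLogic

open CnxLogic

open CnxLogic

namespace CnxLogic

/-! ## Arithmetic of FLe-algebras -/

namespace FLeAlgebra

variable {A : Type u} [FLeAlgebra A]

/-! In an FLew-algebra with `x ⊓ ¬x ≤ 0`, read `w ≤ ¬¬x` as "`w` forces `x`". Pseudo-complementation
yields contraction below `0`: if `x * x ≤ 0` then `x ≤ ¬x`, hence `x ≤ x ⊓ ¬x ≤ 0`. This makes
forcing closed under combining premises (`Forces.mul`), the deduction theorem (`Forces.imp`) and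
case distinction on `x` versus `¬x` (`Forces.cases`): forcing obeys classical logic, although the
algebra does not.

The Glivenko half follows by running the sequent calculus with forcing in place of `≤`
(`SeqDeriv.forces`). All axioms of CPL, double negation elimination included, are forced by `1`, so
every classical theorem holds under a double negation. Conversely, a logic with the Glivenko
property proves `¬¬¬(p ∧ ¬p)`, which is equivalent to `¬(p ∧ ¬p)` already in FLe.

For connexivity, both connectives are biconditionals up to double negation (`IsBicondOp`). The
theses of Aristotle and Boethius reduce to inequalities with right-hand side `0`, where forcing and
`≤` coincide, so truth-table reasoning proves them. In the other direction, `z = x ⊓ ¬x` satisfies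
`z ≤ ¬z`, whence `z` lies below both `z ⇒ ¬z` and `¬z ⇒ z`; refuting either one gives `z ≤ 0`.
Lindenbaum algebras carry this over to logics, and the three-element Heyting chain supplies the
failure of symmetry. -/

theorem le_himp {x y z : A} : x ≤ y ⇨ z ↔ x * y ≤ z := (residuation x y z).symm

theorem le_neg {x y : A} : x ≤ neg y ↔ x * y ≤ 0 := le_himp

theorem himp_mul_le (x y : A) : (x ⇨ y) * x ≤ y := le_himp.1 le_rfl

theorem neg_mul_le (x : A) : neg x * x ≤ 0 := le_neg.1 le_rfl

theorem mul_neg_le (x : A) : x * neg x ≤ 0 := by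
  rw [mul_comm]; exact neg_mul_le x

theorem mul_mono_left {x y : A} (h : x ≤ y) (z : A) : x * z ≤ y * z :=
  le_himp.1 (h.trans (le_himp.2 le_rfl))

theorem mul_mono {x y z w : A} (h : x ≤ y) (k : z ≤ w) : x * z ≤ y * w := by
  refine (mul_mono_left h z).trans ?_
  rw [mul_comm y z, mul_comm y w]
  exact mul_mono_left k y

theorem one_le_himp {x y : A} : 1 ≤ x ⇨ y ↔ x ≤ y := by
  rw [le_himp, one_mul]

theorem one_le_neg {x : A} : 1 ≤ neg x ↔ x ≤ 0 := one_le_himp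

theorem le_neg_neg (x : A) : x ≤ neg (neg x) := le_neg.2 (mul_neg_le x)

theorem neg_anti {x y : A} (h : x ≤ y) : neg y ≤ neg x :=
  le_neg.2 ((mul_mono le_rfl h).trans (neg_mul_le y))

theorem neg_neg_neg (x : A) : neg (neg (neg x)) = neg x :=
  le_antisymm (neg_anti (le_neg_neg x)) (le_neg_neg _)

/-- From `z ≤ ¬x` and `¬x * ¬¬x ≤ 0`. In a product bounded by `0` a factor may thus be replaced by
its double negation. -/
theorem mul_neg_neg_le {x z : A} (h : z * x ≤ 0) : z * neg (neg x) ≤ 0 :=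
  (mul_mono (le_neg.2 h) le_rfl).trans (mul_neg_le _)

theorem sup_mul_le {x y z w : A} (h : x * z ≤ w) (k : y * z ≤ w) : (x ⊔ y) * z ≤ w :=
  le_himp.1 (sup_le (le_himp.2 h) (le_himp.2 k))

end FLeAlgebra

open FLeAlgebra

/-! ## Soundness of the calculus -/

/-- The product of the values of the formulas in a multiset. -/
def ctxEval {A : Type u} [FLeAlgebra A] (e : ℕ → A) (Γ : Multiset Fm) : A :=
  (Γ.map (Term.eval e)).prod

/-- The value of the right-hand side of a sequent, the empty one being `0`. -/
def rhsEval {A : Type u} [FLeAlgebra A] (e : ℕ → A) : Option Fm → A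
  | none => 0
  | some φ => φ.eval e

section Eval

variable {A : Type u} [FLeAlgebra A] (e : ℕ → A)

@[simp] theorem ctxEval_zero : ctxEval e 0 = 1 := by simp [ctxEval]

@[simp] theorem ctxEval_cons (φ : Fm) (Γ : Multiset Fm) :
    ctxEval e (φ ::ₘ Γ) = φ.eval e * ctxEval e Γ := by simp [ctxEval]

@[simp] theorem ctxEval_singleton (φ : Fm) : ctxEval e {φ} = φ.eval e := by simp [ctxEval]

@[simp] theorem ctxEval_add (Γ Δ : Multiset Fm) :
    ctxEval e (Γ + Δ) = ctxEval e Γ * ctxEval e Δ := by simp [ctxEval]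

theorem SeqDeriv.sound {S : Set (Multiset Fm × Option Fm)}
    (hS : ∀ Γ δ, (Γ, δ) ∈ S → ctxEval e Γ ≤ rhsEval e δ) {Γ : Multiset Fm} {δ : Option Fm}
    (h : SeqDeriv S Γ δ) : ctxEval e Γ ≤ rhsEval e δ := by
  induction h with
  | assumption h => exact hS _ _ h
  | id φ => simp [rhsEval]
  | cut _ _ h₁ h₂ =>
    simp only [ctxEval_add, ctxEval_cons] at *
    exact (mul_mono h₁ le_rfl).trans h₂
  | one_left _ h => simpa [Term.eval] using h
  | one_right => simp [rhsEval, Term.eval]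
  | zero_left => simp [rhsEval, Term.eval]
  | zero_right _ h => exact h
  | meet_left₁ _ h =>
    simp only [ctxEval_cons] at *
    exact (mul_mono inf_le_left le_rfl).trans h
  | meet_left₂ _ h =>
    simp only [ctxEval_cons] at *
    exact (mul_mono inf_le_right le_rfl).trans h
  | meet_right _ _ h₁ h₂ => exact le_inf h₁ h₂
  | join_left _ _ h₁ h₂ =>
    simp only [ctxEval_cons] at *
    exact sup_mul_le h₁ h₂
  | join_right₁ _ h => exact h.trans le_sup_left
  | join_right₂ _ h => exact h.trans le_sup_right
  | fusion_left _ h =>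
    simp only [ctxEval_cons, Term.eval, mul_assoc] at *
    exact h
  | fusion_right _ _ h₁ h₂ =>
    rw [ctxEval_add]
    exact mul_mono h₁ h₂
  | @imp_left Γ Δ φ ψ δ _ _ h₁ h₂ =>
    simp only [ctxEval_cons, ctxEval_add, Term.eval, ← mul_assoc] at *
    exact (mul_mono ((mul_mono le_rfl h₁).trans (himp_mul_le _ _)) le_rfl).trans h₂
  | imp_right _ h =>
    simp only [ctxEval_cons] at h
    exact le_himp.2 (by rwa [mul_comm])

end Eval

/-! ## Theorems of substructural logics -/

namespace SubstructuralLogic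

theorem extend_le {K L : SubstructuralLogic} {Ax : Set Fm} (h : K ≤ L)
    (hAx : ∀ φ ∈ Ax, L.1.Thm φ) : K.extend Ax ≤ L := by
  intro Γ φ hφ
  refine L.1.trans Γ _ φ ?_ (h _ _ hφ)
  rintro ψ (hψ | ⟨α, hα, σ, rfl⟩)
  · exact L.1.refl _ _ hψ
  · have := L.1.structural σ _ _ (hAx α hα)
    rw [Set.image_empty] at this
    exact L.1.mono _ _ _ (Set.empty_subset _) this

theorem le_extend (K : SubstructuralLogic) (Ax : Set Fm) : K ≤ K.extend Ax :=
  fun _ _ h => K.1.mono _ _ _ Set.subset_union_left h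

theorem thm_extend (K : SubstructuralLogic) {Ax : Set Fm} {φ : Fm} (h : φ ∈ Ax) :
    (K.extend Ax).1.Thm φ :=
  K.1.refl _ _ (Or.inr (Logic.subset_instances _ h))

theorem FLe_le (K : SubstructuralLogic) : FLe ≤ K := by
  obtain ⟨_, B, rfl⟩ := K
  exact fun _ _ h => FLeLogic.mono _ _ _ Set.subset_union_left h

/-- A substructural logic is determined by its theorems: the instances of its axioms over FLe are
among them. So an `L` above `M` is recovered by adding all theorems of `L` to `M`. -/
theorem isAxiomaticExtension_iff_le {L M : SubstructuralLogic} :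
    L.1.IsAxiomaticExtension M.1 ↔ M ≤ L := by
  constructor
  · rintro ⟨Ax, h⟩ Γ φ hφ
    rw [h]
    exact M.1.mono _ _ _ Set.subset_union_left hφ
  · intro h
    refine ⟨{φ | L.1.Thm φ}, ?_⟩
    refine congrArg Subtype.val (le_antisymm ?_ (extend_le h fun _ hφ => hφ) :
      L = M.extend {φ | L.1.Thm φ})
    obtain ⟨_, B, rfl⟩ := L
    intro Γ φ hφ
    refine FLe_le M _ _ (FLeLogic.mono _ _ _ (Set.union_subset_union_right _ ?_) hφ)
    exact fun ψ hψ => Logic.subset_instances _ (FLeLogic.refl _ _ (Or.inr hψ))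

end SubstructuralLogic

theorem eval_subst {V : Type v} {W : Type*} {A : Type u} [FLeAlgebra A] (σ : V → Term W)
    (e : W → A) (φ : Term V) :
    (φ.subst σ).eval e = φ.eval (fun n => (σ n).eval e) := by
  induction φ <;> simp_all [Term.subst, Term.eval]

@[simp] theorem eval_neg {V : Type v} {A : Type u} [FLeAlgebra A] (e : V → A) (φ : Term V) :
    φ.neg.eval e = neg (φ.eval e) := rfl

/-- Algebras in the variety of a logic preserve its consequence relation pointwise. -/
theorem InVariety.sound {K : SubstructuralLogic} {A : Type u} [FLeAlgebra A]
    (h : InVariety K.1 A) {Γ : Set Fm} {φ : Fm} (hφ : K.1.Deriv Γ φ) (e : ℕ → A)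
    (hΓ : ∀ ψ ∈ Γ, 1 ≤ ψ.eval e) : 1 ≤ φ.eval e := by
  obtain ⟨_, B, rfl⟩ := K
  have := SeqDeriv.sound e (S := asserted (Γ ∪ Logic.instances B)) ?_ hφ
  · simpa [rhsEval] using this
  · rintro Δ δ ⟨ψ, hψ, hs⟩
    obtain ⟨rfl, rfl⟩ := Prod.mk.inj hs
    rw [ctxEval_zero]
    rcases hψ with hψ | hψ
    · exact hΓ ψ hψ
    · exact h ψ (FLeLogic.refl _ _ (Or.inr hψ)) e

theorem InVariety.extend {K : SubstructuralLogic} {Ax : Set Fm} {A : Type u} [FLeAlgebra A]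
    (h : InVariety K.1 A) (hAx : ∀ φ ∈ Ax, ∀ e : ℕ → A, 1 ≤ φ.eval e) :
    InVariety (K.extend Ax).1 A := by
  intro φ hφ e
  refine h.sound hφ e ?_
  rintro ψ (hψ | ⟨α, hα, σ, rfl⟩)
  · exact hψ.elim
  · rw [eval_subst]
    exact hAx α hα _

theorem InVariety.mono {K L : SubstructuralLogic} (hKL : K ≤ L) {A : Type u} [FLeAlgebra A]
    (h : InVariety L.1 A) : InVariety K.1 A :=
  fun φ hφ e => h φ (hKL _ _ hφ) e

theorem inVariety_FLe (A : Type u) [FLeAlgebra A] : InVariety SubstructuralLogic.FLe.1 A := by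
  intro φ hφ e
  have := SeqDeriv.sound e (S := asserted ∅) (by rintro Γ δ ⟨_, h, _⟩; exact h.elim) hφ
  simpa [rhsEval] using this

/-! ## The Lindenbaum algebra -/

/-- Cut makes the rule invertible, as in the next two lemmas; in the quotient this becomes the
residuation law. -/
theorem SeqDeriv.imp_iff {S : Set (Multiset Fm × Option Fm)} {Γ : Multiset Fm} {φ ψ : Fm} :
    SeqDeriv S Γ (some (φ.imp ψ)) ↔ SeqDeriv S (φ ::ₘ Γ) (some ψ) := by
  refine ⟨fun h => ?_, .imp_right⟩
  have : SeqDeriv S (φ.imp ψ ::ₘ ({φ} + 0)) (some ψ) := .imp_left (.id φ) (.id ψ)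
  have := SeqDeriv.cut h this
  rwa [add_zero, Multiset.add_comm, Multiset.singleton_add] at this

theorem SeqDeriv.fusion_iff {S : Set (Multiset Fm × Option Fm)} {Γ : Multiset Fm} {φ ψ : Fm}
    {δ : Option Fm} : SeqDeriv S (φ.fusion ψ ::ₘ Γ) δ ↔ SeqDeriv S (φ ::ₘ ψ ::ₘ Γ) δ := by
  refine ⟨fun h => ?_, .fusion_left⟩
  have : SeqDeriv S ({φ} + {ψ}) (some (φ.fusion ψ)) := .fusion_right (.id φ) (.id ψ)
  simpa using SeqDeriv.cut this h

theorem SeqDeriv.one_iff {S : Set (Multiset Fm × Option Fm)} {Γ : Multiset Fm}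
    {δ : Option Fm} : SeqDeriv S (Term.one ::ₘ Γ) δ ↔ SeqDeriv S Γ δ := by
  refine ⟨fun h => ?_, .one_left⟩
  simpa using SeqDeriv.cut .one_right h

theorem SeqDeriv.trans_singleton {S : Set (Multiset Fm × Option Fm)} {φ ψ : Fm} {δ : Option Fm}
    (h : SeqDeriv S {φ} (some ψ)) (k : SeqDeriv S {ψ} δ) : SeqDeriv S {φ} δ := by
  simpa using SeqDeriv.cut (Δ := 0) h k

/-- Provable equivalence from a set of sequents. -/
@[reducible] def entailSetoid (S : Set (Multiset Fm × Option Fm)) : Setoid Fm where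
  r φ ψ := SeqDeriv S {φ} (some ψ) ∧ SeqDeriv S {ψ} (some φ)
  iseqv :=
    ⟨fun φ => ⟨.id φ, .id φ⟩, fun h => ⟨h.2, h.1⟩,
      fun h k => ⟨h.1.trans_singleton k.1, k.2.trans_singleton h.2⟩⟩

/-- The quotient of the formulas by provable equivalence. -/
def Lindenbaum (S : Set (Multiset Fm × Option Fm)) : Type := Quotient (entailSetoid S)

namespace Lindenbaum

variable {S : Set (Multiset Fm × Option Fm)}

/-- The class of a formula. -/
def mk (S : Set (Multiset Fm × Option Fm)) (φ : Fm) : Lindenbaum S := Quotient.mk _ φ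

theorem mk_eq {φ ψ : Fm} :
    mk S φ = mk S ψ ↔ SeqDeriv S {φ} (some ψ) ∧ SeqDeriv S {ψ} (some φ) :=
  Quotient.eq (r := entailSetoid S)

theorem ind {p : Lindenbaum S → Prop} (h : ∀ φ, p (mk S φ)) (x : Lindenbaum S) : p x :=
  Quotient.ind h x

theorem meet_mono {φ φ' ψ ψ' : Fm} (h : SeqDeriv S {φ} (some φ')) (k : SeqDeriv S {ψ} (some ψ')) :
    SeqDeriv S {φ.meet ψ} (some (φ'.meet ψ')) :=
  .meet_right (.meet_left₁ (Γ := 0) h) (.meet_left₂ (Γ := 0) k)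

theorem join_mono {φ φ' ψ ψ' : Fm} (h : SeqDeriv S {φ} (some φ')) (k : SeqDeriv S {ψ} (some ψ')) :
    SeqDeriv S {φ.join ψ} (some (φ'.join ψ')) :=
  .join_left (Γ := 0) (.join_right₁ h) (.join_right₂ k)

theorem fusion_mono {φ φ' ψ ψ' : Fm} (h : SeqDeriv S {φ} (some φ'))
    (k : SeqDeriv S {ψ} (some ψ')) : SeqDeriv S {φ.fusion ψ} (some (φ'.fusion ψ')) :=
  .fusion_left (Γ := 0) (by simpa using SeqDeriv.fusion_right h k)

theorem imp_mono {φ φ' ψ ψ' : Fm} (h : SeqDeriv S {φ'} (some φ))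
    (k : SeqDeriv S {ψ} (some ψ')) : SeqDeriv S {φ.imp ψ} (some (φ'.imp ψ')) := by
  refine .imp_right ?_
  have := SeqDeriv.imp_left (Δ := 0) h k
  rw [add_zero] at this
  rwa [show φ' ::ₘ {φ.imp ψ} = φ.imp ψ ::ₘ {φ'} from Multiset.cons_swap _ _ 0]

instance : PartialOrder (Lindenbaum S) where
  le := Quotient.lift₂ (fun φ ψ => SeqDeriv S {φ} (some ψ)) fun _ _ _ _ h k =>
    propext ⟨fun l => h.2.trans_singleton (l.trans_singleton k.1),
      fun l => h.1.trans_singleton (l.trans_singleton k.2)⟩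
  le_refl := ind fun φ => .id φ
  le_trans := ind fun _ => ind fun _ => ind fun _ h k => h.trans_singleton k
  le_antisymm := ind fun _ => ind fun _ h k => mk_eq.2 ⟨h, k⟩

instance : Lattice (Lindenbaum S) where
  inf := Quotient.map₂ Term.meet fun _ _ h _ _ k => ⟨meet_mono h.1 k.1, meet_mono h.2 k.2⟩
  sup := Quotient.map₂ Term.join fun _ _ h _ _ k => ⟨join_mono h.1 k.1, join_mono h.2 k.2⟩
  inf_le_left := ind fun φ => ind fun _ => .meet_left₁ (Γ := 0) (.id φ)
  inf_le_right := ind fun _ => ind fun ψ => .meet_left₂ (Γ := 0) (.id ψ)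
  le_inf := ind fun _ => ind fun _ => ind fun _ h k => .meet_right h k
  le_sup_left := ind fun φ => ind fun _ => .join_right₁ (.id φ)
  le_sup_right := ind fun _ => ind fun ψ => .join_right₂ (.id ψ)
  sup_le := ind fun _ => ind fun _ => ind fun _ h k => .join_left (Γ := 0) h k

instance : Mul (Lindenbaum S) :=
  ⟨Quotient.map₂ Term.fusion fun _ _ h _ _ k => ⟨fusion_mono h.1 k.1, fusion_mono h.2 k.2⟩⟩

theorem mk_mul_le {φ ψ χ : Fm} :
    mk S φ * mk S ψ ≤ mk S χ ↔ SeqDeriv S {φ, ψ} (some χ) :=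
  SeqDeriv.fusion_iff (Γ := 0)

theorem mul_comm_le (x y : Lindenbaum S) : x * y ≤ y * x := by
  induction x using ind with | _ φ
  induction y using ind with | _ ψ
  exact mk_mul_le.2 (by
    rw [Multiset.pair_comm]
    simpa using SeqDeriv.fusion_right (SeqDeriv.id (S := S) ψ) (.id φ))

theorem mul_assoc_le (x y z : Lindenbaum S) : x * y * z ≤ x * (y * z) := by
  induction x using ind with | _ φ
  induction y using ind with | _ ψ
  induction z using ind with | _ χ
  refine (mk_mul_le (φ := φ.fusion ψ)).2 (.fusion_left ?_)
  simpa only [Multiset.singleton_add] using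
    SeqDeriv.fusion_right (SeqDeriv.id (S := S) φ) (.fusion_right (.id ψ) (.id χ))

theorem le_mul_assoc (x y z : Lindenbaum S) : x * (y * z) ≤ x * y * z := by
  induction x using ind with | _ φ
  induction y using ind with | _ ψ
  induction z using ind with | _ χ
  refine (mk_mul_le (ψ := ψ.fusion χ)).2 ?_
  rw [Multiset.pair_comm]
  refine .fusion_left ?_
  have := SeqDeriv.fusion_right (.fusion_right (SeqDeriv.id (S := S) φ) (.id ψ)) (.id χ)
  convert this using 1
  simp only [← Multiset.singleton_add]
  abel

instance : FLeAlgebra (Lindenbaum S) where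
  mul_assoc x y z := le_antisymm (mul_assoc_le x y z) (le_mul_assoc x y z)
  mul_comm x y := le_antisymm (mul_comm_le x y) (mul_comm_le y x)
  one := mk S .one
  one_mul := ind fun φ => le_antisymm (mk_mul_le.2 (.one_left (.id φ)))
    (SeqDeriv.trans_singleton (by simpa using SeqDeriv.fusion_right .one_right (.id φ)) (.id _))
  mul_one := ind fun φ => le_antisymm
    (mk_mul_le.2 (by rw [Multiset.pair_comm]; exact .one_left (.id φ)))
    (SeqDeriv.trans_singleton (by simpa using SeqDeriv.fusion_right (.id φ) .one_right) (.id _))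
  himp := Quotient.map₂ Term.imp fun _ _ h _ _ k => ⟨imp_mono h.2 k.1, imp_mono h.1 k.2⟩
  zero := mk S .zero
  residuation := ind fun φ => ind fun ψ => ind fun χ => by
    rw [mk_mul_le, Multiset.pair_comm]
    exact SeqDeriv.imp_iff.symm

theorem one_le_mk {φ : Fm} : 1 ≤ mk S φ ↔ SeqDeriv S 0 (some φ) := SeqDeriv.one_iff (Γ := 0)

theorem eval_mk (σ : ℕ → Fm) (φ : Fm) :
    φ.eval (fun n => mk S (σ n)) = mk S (φ.subst σ) := by
  induction φ with
  | var => rfl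
  | zero => rfl
  | one => rfl
  | meet _ _ h k => simp only [Term.eval, h, k]; rfl
  | join _ _ h k => simp only [Term.eval, h, k]; rfl
  | fusion _ _ h k => simp only [Term.eval, h, k]; rfl
  | imp _ _ h k => simp only [Term.eval, h, k]; rfl

end Lindenbaum

namespace SubstructuralLogic

/-- The Lindenbaum algebra of a substructural logic. -/
abbrev Lind (L : SubstructuralLogic) : Type := Lindenbaum (asserted {φ | L.1.Thm φ})

/-- The theorems of `L` are closed under the consequence relation of FLe, so using them as initial
sequents proves nothing new. -/
theorem seqDeriv_iff_thm {L : SubstructuralLogic} {φ : Fm} :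
    SeqDeriv (asserted {φ | L.1.Thm φ}) 0 (some φ) ↔ L.1.Thm φ :=
  ⟨fun h => L.1.trans _ _ _ (fun _ hψ => hψ) (FLe_le L _ _ h), fun h => .assumption ⟨φ, h, rfl⟩⟩

/-- Choosing representatives turns an assignment into a substitution, so validity is closure of the
theorems under substitution. -/
theorem inVariety_lind (L : SubstructuralLogic) : InVariety L.1 L.Lind := by
  intro φ hφ e
  choose σ hσ using fun n => Quotient.exists_rep (e n)
  obtain rfl : (fun n => Lindenbaum.mk _ (σ n)) = e := funext hσ
  rw [Lindenbaum.eval_mk, Lindenbaum.one_le_mk, seqDeriv_iff_thm]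
  simpa [Logic.Thm] using L.1.structural σ _ _ hφ

theorem thm_iff {L : SubstructuralLogic} {φ : Fm} :
    L.1.Thm φ ↔ 1 ≤ φ.eval fun n => Lindenbaum.mk (asserted {φ | L.1.Thm φ}) (.var n) := by
  rw [Lindenbaum.eval_mk, Lindenbaum.one_le_mk, seqDeriv_iff_thm, Term.subst_var]

/-- Formulas valid in the Lindenbaum algebra are theorems. -/
theorem thm_of_forall {L : SubstructuralLogic} {φ : Fm} (h : ∀ e : ℕ → L.Lind, 1 ≤ φ.eval e) :
    L.1.Thm φ :=
  thm_iff.2 (h _)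

end SubstructuralLogic

/-! ## Lifting algebras to other universes -/

instance {A : Type u} [FLeAlgebra A] : FLeAlgebra (ULift.{v} A) where
  himp x y := ⟨x.down ⇨ y.down⟩
  zero := ⟨0⟩
  residuation x y z := residuation x.down y.down z.down

theorem eval_uLift {V : Type*} {A : Type u} [FLeAlgebra A] (e : V → ULift.{v} A) (φ : Term V) :
    φ.eval e = ⟨φ.eval fun n => (e n).down⟩ := by
  induction φ with
  | var => rfl
  | zero => rfl
  | one => rfl
  | meet _ _ h k => simp only [Term.eval, h, k]; rfl
  | join _ _ h k => simp only [Term.eval, h, k]; rfl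
  | fusion _ _ h k => simp only [Term.eval, h, k]; rfl
  | imp _ _ h k => simp only [Term.eval, h, k]; rfl

theorem InVariety.uLift {L : Logic} {A : Type u} [FLeAlgebra A] (h : InVariety L A) :
    InVariety L (ULift.{v} A) := by
  intro φ hφ e
  rw [eval_uLift]
  exact h φ hφ _

/-! ## Pseudo-complemented FLew-algebras -/

/-- An FLe-algebra in which `1` is the top element and `0` the bottom element. -/
class IsFLew (A : Type u) [FLeAlgebra A] : Prop where
  le_one : ∀ x : A, x ≤ 1
  zero_le : ∀ x : A, 0 ≤ x

/-- An FLew-algebra in which `x ∧ ¬x = 0`. -/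
class IsPseudoCompl (A : Type u) [FLeAlgebra A] : Prop extends IsFLew A where
  inf_neg_le : ∀ x : A, x ⊓ neg x ≤ 0

namespace FLeAlgebra

section FLew

variable {A : Type u} [FLeAlgebra A] [IsFLew A]

theorem mul_le_left (x y : A) : x * y ≤ x := by
  simpa using mul_mono (le_refl x) (IsFLew.le_one y)

theorem mul_le_right (x y : A) : x * y ≤ y := by
  rw [mul_comm]; exact mul_le_left y x

theorem mul_le_inf (x y : A) : x * y ≤ x ⊓ y := le_inf (mul_le_left x y) (mul_le_right x y)

theorem le_himp_self (x y : A) : y ≤ x ⇨ y := le_himp.2 (mul_le_left y x)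

theorem neg_le_himp (x y : A) : neg x ≤ x ⇨ y :=
  le_himp.2 ((neg_mul_le x).trans (IsFLew.zero_le y))

end FLew

/-- `w` forces `x` up to double negation. -/
def Forces {A : Type u} [FLeAlgebra A] (w x : A) : Prop := w ≤ neg (neg x)

namespace Forces

variable {A : Type u} [FLeAlgebra A] {w w' x y : A}

theorem of_le (h : w ≤ x) : Forces w x := h.trans (le_neg_neg x)

theorem self (w : A) : Forces w w := of_le le_rfl

theorem anti (h : Forces w x) (k : w' ≤ w) : Forces w' x := k.trans h

theorem mono (h : Forces w x) (k : x ≤ y) : Forces w y := h.trans (neg_anti (neg_anti k))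

theorem of_neg_neg (h : Forces w (neg (neg x))) : Forces w x := by
  rwa [Forces, neg_neg_neg] at h

theorem iff_mul_neg_le : Forces w x ↔ w * neg x ≤ 0 := le_neg

theorem le_zero (h : Forces w 0) : w ≤ 0 := by
  have h₁ : (1 : A) ≤ neg 0 := one_le_neg.2 le_rfl
  simpa using (mul_mono (le_refl w) h₁).trans (iff_mul_neg_le.1 h)

end Forces

variable {A : Type u} [FLeAlgebra A] [IsPseudoCompl A]

/-- The only direct use of pseudo-complementation in the forcing calculus: contraction for
inequalities with right-hand side `0`. -/
theorem le_zero_of_mul_self {x : A} (h : x * x ≤ 0) : x ≤ 0 :=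
  (le_inf le_rfl (le_neg.2 h)).trans (IsPseudoCompl.inf_neg_le x)

namespace Forces

variable {w x y z : A}

theorem mul_left (w x : A) : Forces (w * x) w := of_le (mul_le_left w x)

theorem mul_right (w x : A) : Forces (w * x) x := of_le (mul_le_right w x)

theorem weaken (h : Forces w x) (y : A) : Forces (w * y) x := h.anti (mul_le_left w y)

theorem mul (hx : Forces w x) (hy : Forces w y) (h : x * y ≤ z) : Forces w z := by
  have h₁ : neg z * y * x ≤ 0 := by
    rw [mul_assoc, mul_comm y x]
    exact (mul_mono le_rfl h).trans (neg_mul_le z)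
  have h₂ : neg z * w * y ≤ 0 := by
    rw [mul_right_comm]
    exact (mul_mono le_rfl hx).trans (mul_neg_neg_le h₁)
  have h₃ : neg z * w * w ≤ 0 := (mul_mono le_rfl hy).trans (mul_neg_neg_le h₂)
  rw [iff_mul_neg_le, mul_comm]
  -- The two premises consume `w` twice. Squaring `neg z * w` provides both copies, and weakening
  -- discards the spare `neg z`.
  refine le_zero_of_mul_self (le_trans ?_ h₃)
  rw [← mul_assoc]
  exact mul_mono_left (mul_le_left _ _) w

/-- The first case says `w * ¬y ≤ ¬x`, the second `w * ¬x * ¬y ≤ 0`. So the square of `w * ¬y` is at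
most `0`, and contraction applies. -/
theorem cases (x : A) (h : Forces (w * x) y) (k : Forces (w * neg x) y) : Forces w y := by
  rw [iff_mul_neg_le] at *
  have h₁ : w * neg y ≤ neg x := le_neg.2 (by rwa [mul_right_comm])
  refine le_zero_of_mul_self ((mul_mono le_rfl h₁).trans ?_)
  rwa [mul_right_comm]

theorem imp (h : Forces (x * w) y) : Forces w (x ⇨ y) :=
  cases x ((mul_comm w x ▸ h).mono (le_himp_self x y)) ((mul_right w _).mono (neg_le_himp x y))

theorem contradiction (h : Forces w x) (k : Forces w (neg x)) : Forces w y :=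
  h.mul k ((mul_neg_le x).trans (IsFLew.zero_le y))

end Forces

end FLeAlgebra

/-! ## Glivenko's theorem -/

/-- Initial sequents need only be forced rather than valid, which admits double negation elimination
as an axiom. -/
theorem SeqDeriv.forces {A : Type u} [FLeAlgebra A] [IsPseudoCompl A] (e : ℕ → A)
    {S : Set (Multiset Fm × Option Fm)}
    (hS : ∀ Γ δ, (Γ, δ) ∈ S → Forces (ctxEval e Γ) (rhsEval e δ)) {Γ : Multiset Fm}
    {δ : Option Fm} (h : SeqDeriv S Γ δ) : Forces (ctxEval e Γ) (rhsEval e δ) := by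
  induction h with
  | assumption h => exact hS _ _ h
  | id φ => simpa [rhsEval] using Forces.self (φ.eval e)
  | @cut Γ Δ φ δ _ _ h₁ h₂ =>
    simp only [ctxEval_add, ctxEval_cons] at *
    exact (h₂.imp.anti (mul_le_right _ _)).mul (h₁.weaken _) (himp_mul_le _ _)
  | one_left _ h => simpa [Term.eval] using h
  | one_right => simpa [rhsEval, Term.eval] using Forces.self (1 : A)
  | zero_left => simpa [rhsEval, Term.eval] using Forces.self (0 : A)
  | zero_right _ h => exact h
  | meet_left₁ _ h =>
    simp only [ctxEval_cons] at *
    exact h.anti (mul_mono inf_le_left le_rfl)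
  | meet_left₂ _ h =>
    simp only [ctxEval_cons] at *
    exact h.anti (mul_mono inf_le_right le_rfl)
  | meet_right _ _ h₁ h₂ => exact h₁.mul h₂ (mul_le_inf _ _)
  | join_left _ _ h₁ h₂ =>
    simp only [ctxEval_cons] at *
    exact sup_mul_le h₁ h₂
  | join_right₁ _ h => exact h.mono le_sup_left
  | join_right₂ _ h => exact h.mono le_sup_right
  | fusion_left _ h =>
    simp only [ctxEval_cons, Term.eval, mul_assoc] at *
    exact h
  | fusion_right _ _ h₁ h₂ =>
    rw [ctxEval_add]
    exact (h₁.weaken _).mul (h₂.anti (mul_le_right _ _)) le_rfl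
  | @imp_left Γ Δ φ ψ δ _ _ h₁ h₂ =>
    simp only [ctxEval_cons, ctxEval_add, Term.eval] at *
    refine Forces.mul ?_ ?_ (himp_mul_le (ψ.eval e) _)
    · exact h₂.imp.anti ((mul_le_right _ _).trans (mul_le_right _ _))
    · exact (Forces.mul_left _ _).mul
        (h₁.anti ((mul_le_right _ _).trans (mul_le_left _ _))) (himp_mul_le _ _)
  | imp_right _ h =>
    simp only [ctxEval_cons] at h
    exact h.imp

/-! ## Connectives behaving like the biconditional up to double negation -/

/-- The binary operation `r` lies between `(x → y) · (y → ¬¬x)` and `(x → y) ∧ (y → ¬¬x)`. -/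
structure IsBicondOp {A : Type u} [FLeAlgebra A] (r : A → A → A) : Prop where
  le_left : ∀ x y, r x y ≤ x ⇨ y
  le_right : ∀ x y, r x y ≤ y ⇨ neg (neg x)
  mul_le : ∀ x y, (x ⇨ y) * (y ⇨ neg (neg x)) ≤ r x y

namespace IsBicondOp

variable {A : Type u} [FLeAlgebra A] {r : A → A → A}

theorem one_le (hr : IsBicondOp r) {x y : A} (h : x ≤ y) (k : y ≤ neg (neg x)) : 1 ≤ r x y := by
  have := mul_mono (one_le_himp.2 h) (one_le_himp.2 k)
  rw [mul_one] at this
  exact this.trans (hr.mul_le x y)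

/-- Each of Aristotle's theses forces pseudo-complementation. -/
theorem inf_neg_le_of_at₁ [IsFLew A] (hr : IsBicondOp r) (h : ∀ x : A, 1 ≤ neg (r x (neg x)))
    (x : A) : x ⊓ neg x ≤ 0 := by
  set z := x ⊓ neg x with hz
  -- Since `z * z ≤ x * neg x ≤ 0`, the first factor of `r z (neg z)` is above `1`; the second is
  -- above `z` by weakening.
  have h₁ : z ≤ neg z := le_neg.2 ((mul_mono inf_le_left inf_le_right).trans (mul_neg_le x))
  have h₂ : z ≤ neg z ⇨ neg (neg z) := (le_neg_neg z).trans (le_himp_self _ _)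
  calc z = 1 * z := (one_mul z).symm
    _ ≤ _ := mul_mono (one_le_himp.2 h₁) h₂
    _ ≤ r z (neg z) := hr.mul_le _ _
    _ ≤ 0 := one_le_neg.1 (h z)

theorem inf_neg_le_of_at₂ [IsFLew A] (hr : IsBicondOp r) (h : ∀ x : A, 1 ≤ neg (r (neg x) x))
    (x : A) : x ⊓ neg x ≤ 0 := by
  set z := x ⊓ neg x with hz
  have h₁ : z ≤ neg z := le_neg.2 ((mul_mono inf_le_left inf_le_right).trans (mul_neg_le x))
  -- The roles swap: by triple negation the second factor is now above `1`, and weakening puts the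
  -- first above `z`.
  have h₂ : 1 ≤ z ⇨ neg (neg (neg z)) := one_le_himp.2 (by rwa [neg_neg_neg])
  calc z = z * 1 := (mul_one z).symm
    _ ≤ _ := mul_mono (le_himp_self (neg z) z) h₂
    _ ≤ r (neg z) z := hr.mul_le _ _
    _ ≤ 0 := one_le_neg.1 (h z)

variable [IsPseudoCompl A]

theorem forces_right (hr : IsBicondOp r) {w x y : A} (h : Forces w (r x y)) (k : Forces w x) :
    Forces w y :=
  (h.mono (hr.le_left x y)).mul k (himp_mul_le _ _)

theorem forces_left (hr : IsBicondOp r) {w x y : A} (h : Forces w (r x y)) (k : Forces w y) :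
    Forces w x :=
  ((h.mono (hr.le_right x y)).mul k (himp_mul_le _ _)).of_neg_neg

theorem forces_of_forces (hr : IsBicondOp r) {w x y : A} (h : Forces w x) (k : Forces w y) :
    Forces w (r x y) :=
  (k.mono (le_himp_self x y)).mul (h.mono ((le_neg_neg x).trans (le_himp_self y _)))
    (hr.mul_le x y)

theorem forces_of_forces_neg (hr : IsBicondOp r) {w x y : A} (h : Forces w (neg x))
    (k : Forces w (neg y)) : Forces w (r x y) :=
  (h.mono (neg_le_himp x y)).mul (k.mono (neg_le_himp y _)) (hr.mul_le x y)

theorem not_at₁ (hr : IsBicondOp r) (x : A) : r x (neg x) ≤ 0 := by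
  refine Forces.le_zero (.cases x ?_ ?_)
  · exact (Forces.mul_right _ _).contradiction
      (hr.forces_right (.mul_left _ _) (.mul_right _ _))
  · exact (hr.forces_left (.mul_left _ _) (.mul_right _ _)).contradiction (.mul_right _ _)

theorem not_at₂ (hr : IsBicondOp r) (x : A) : r (neg x) x ≤ 0 := by
  refine Forces.le_zero (.cases x ?_ ?_)
  · exact (Forces.mul_right _ _).contradiction
      (hr.forces_left (.mul_left _ _) (.mul_right _ _))
  · exact (hr.forces_right (.mul_left _ _) (.mul_right _ _)).contradiction (.mul_right _ _)

/-- Together with the next lemma this says that `r x y` and `r x (neg y)` are negations of each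
other up to double negation, which is what both of Boethius' theses require. The cases are the rows
of the truth table. -/
theorem mul_le_zero (hr : IsBicondOp r) (x y : A) : r x y * r x (neg y) ≤ 0 := by
  have h₁ := Forces.mul_left (r x y) (r x (neg y))
  have h₂ := Forces.mul_right (r x y) (r x (neg y))
  refine Forces.le_zero (.cases x ?_ (.cases y ?_ ?_))
  · exact (hr.forces_right (h₁.weaken _) (.mul_right _ _)).contradiction
      (hr.forces_right (h₂.weaken _) (.mul_right _ _))
  · exact (hr.forces_left ((h₁.weaken _).weaken _) (.mul_right _ _)).contradiction
      ((Forces.mul_right _ _).weaken _)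
  · exact (hr.forces_left ((h₂.weaken _).weaken _) (.mul_right _ _)).contradiction
      ((Forces.mul_right _ _).weaken _)

theorem neg_mul_neg_le_zero (hr : IsBicondOp r) (x y : A) :
    neg (r x y) * neg (r x (neg y)) ≤ 0 := by
  have h₁ := Forces.mul_left (neg (r x y)) (neg (r x (neg y)))
  have h₂ := Forces.mul_right (neg (r x y)) (neg (r x (neg y)))
  refine Forces.le_zero (.cases x (.cases y ?_ ?_) (.cases y ?_ ?_))
  · exact (hr.forces_of_forces ((Forces.mul_right _ _).weaken _) (.mul_right _ _)).contradiction
      ((h₁.weaken _).weaken _)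
  · exact (hr.forces_of_forces ((Forces.mul_right _ _).weaken _) (.mul_right _ _)).contradiction
      ((h₂.weaken _).weaken _)
  · exact (hr.forces_of_forces_neg ((Forces.mul_right _ _).weaken _)
      ((Forces.mul_right _ _).mono (le_neg_neg y))).contradiction ((h₂.weaken _).weaken _)
  · exact (hr.forces_of_forces_neg ((Forces.mul_right _ _).weaken _)
      (.mul_right _ _)).contradiction ((h₁.weaken _).weaken _)

theorem isProtoConnexiveOp (hr : IsBicondOp r) : IsProtoConnexiveOp r where
  at₁ x := one_le_neg.2 (hr.not_at₁ x)
  at₂ x := one_le_neg.2 (hr.not_at₂ x)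
  bt₁ x y := hr.one_le (le_neg.2 (hr.mul_le_zero x y))
    (le_neg.2 (by rw [mul_comm]; exact hr.neg_mul_neg_le_zero x y))
  bt₂ x y := hr.one_le (le_neg.2 (by rw [mul_comm]; exact hr.mul_le_zero x y))
    (le_neg.2 (hr.neg_mul_neg_le_zero x y))

end IsBicondOp

theorem isBicondOp_of_mem {t : BinTerm}
    (ht : t ∈ ({BinTerm.cnxFusion, BinTerm.cnxMeet} : Set BinTerm)) (A : Type u) [FLeAlgebra A]
    [IsFLew A] : IsBicondOp (t.op (A := A)) := by
  rcases ht with rfl | rfl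
  · exact ⟨fun _ _ => mul_le_left _ _, fun _ _ => mul_le_right _ _, fun _ _ => le_rfl⟩
  · exact ⟨fun _ _ => inf_le_left, fun _ _ => inf_le_right, fun _ _ => mul_le_inf _ _⟩

/-! ## Heyting algebras as FLe-algebras -/

/-- A Heyting algebra, to be regarded as an FLe-algebra with `x · y = x ∧ y`. -/
def OfHeyting (H : Type u) : Type u := H

instance (H : Type u) [HeytingAlgebra H] : FLeAlgebra (OfHeyting H) where
  toLattice := inferInstanceAs (Lattice H)
  mul x y := (x ⊓ y : H)
  mul_assoc := inf_assoc (α := H)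
  mul_comm := inf_comm (α := H)
  one := (⊤ : H)
  one_mul := top_inf_eq (α := H)
  mul_one := inf_top_eq (α := H)
  himp x y := (x ⇨ y : H)
  zero := (⊥ : H)
  residuation _ _ _ := (le_himp_iff (α := H)).symm

instance (H : Type u) [HeytingAlgebra H] : IsPseudoCompl (OfHeyting H) where
  le_one _ := le_top (α := H)
  zero_le _ := bot_le (α := H)
  inf_neg_le x := neg_mul_le x |>.trans' (inf_comm (α := H) x _).le

instance {A : Type u} [FLeAlgebra A] [h : IsPseudoCompl A] : IsPseudoCompl (ULift.{v} A) where
  le_one x := h.le_one x.down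
  zero_le x := h.zero_le x.down
  inf_neg_le x := h.inf_neg_le x.down

/-! ### Axiomatization of the Glivenko logic by pseudo-complementation -/

namespace SubstructuralLogic

/-- FLew plus pseudo-complementation. -/
abbrev pseudoComplLogic : SubstructuralLogic :=
  FLew.extend {((Term.var 0).meet (Term.var 0).neg).imp Term.zero}

theorem inVariety_FLew (A : Type u) [FLeAlgebra A] [h : IsFLew A] : InVariety FLew.1 A := by
  refine (inVariety_FLe A).extend ?_
  rintro _ (rfl | rfl) e
  · exact one_le_himp.2 (h.le_one _)
  · exact one_le_himp.2 (h.zero_le _)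

theorem inVariety_IPL_ofHeyting (H : Type u) [HeytingAlgebra H] :
    InVariety IPL.1 (OfHeyting H) := by
  refine (inVariety_FLew _).extend ?_
  rintro _ rfl e
  exact one_le_himp.2 le_rfl

theorem isFLew_of_inVariety {L : SubstructuralLogic} (hL : FLew ≤ L) {A : Type u} [FLeAlgebra A]
    (h : InVariety L.1 A) : IsFLew A where
  le_one x := one_le_himp.1
    (h.mono hL _ (thm_extend _ (Or.inl rfl)) fun _ => x)
  zero_le x := one_le_himp.1
    (h.mono hL _ (thm_extend _ (Or.inr rfl)) fun _ => x)

theorem isPseudoCompl_of_inVariety {L : SubstructuralLogic} (hL : pseudoComplLogic ≤ L)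
    {A : Type u} [FLeAlgebra A] (h : InVariety L.1 A) : IsPseudoCompl A where
  toIsFLew := isFLew_of_inVariety ((le_extend _ _).trans hL) h
  inf_neg_le x := one_le_himp.1
    (h.mono hL _ (thm_extend _ rfl) fun _ => x)

theorem pseudoComplLogic_le {L : SubstructuralLogic} (hL : FLew ≤ L)
    (h : ∀ x : L.Lind, x ⊓ neg x ≤ 0) : pseudoComplLogic ≤ L := by
  refine extend_le hL ?_
  rintro _ rfl
  exact thm_of_forall fun e => one_le_himp.2 (h _)

theorem FLew_le_IPL : FLew ≤ IPL := le_extend _ _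

theorem pseudoComplLogic_le_IPL : pseudoComplLogic ≤ IPL := by
  refine pseudoComplLogic_le FLew_le_IPL fun x => ?_
  -- The axiom `p ∧ q → p · q` at `p = x`, `q = neg x`; the product is at most `0`.
  have := inVariety_lind IPL _ (thm_extend _ rfl) fun n => if n = 0 then x else neg x
  exact (one_le_himp.1 this).trans (mul_neg_le x)

theorem pseudoComplLogic_le_CPL : pseudoComplLogic ≤ CPL :=
  pseudoComplLogic_le_IPL.trans (le_extend _ _)

/-- Glivenko's theorem for pseudo-complemented FLew-algebras. -/
theorem one_le_neg_neg_of_thm_CPL {φ : Fm} (hφ : CPL.1.Thm φ) {A : Type u} [FLeAlgebra A]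
    [IsPseudoCompl A] (e : ℕ → A) : 1 ≤ neg (neg (φ.eval e)) := by
  -- Unfolding CPL down to FLe leaves no premises besides the instances of double negation
  -- elimination, of `p ∧ q → p · q`, and of weakening, in this order.
  have := SeqDeriv.forces e (S := asserted (((((∅ ∪ Logic.instances _) ∪ Logic.instances _) ∪
    Logic.instances _)))) ?_ hφ
  · simpa [rhsEval, Forces] using this
  · rintro Γ δ ⟨ψ, hψ, h⟩
    obtain ⟨rfl, rfl⟩ := Prod.mk.inj h
    rw [ctxEval_zero]
    have key : ∀ {x y : A}, Forces x y → Forces 1 (x ⇨ y) := fun h =>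
      Forces.imp (by rwa [mul_one])
    rcases hψ with (((h | ⟨_, rfl, σ, rfl⟩) | ⟨_, rfl, σ, rfl⟩) | ⟨_, rfl | rfl, σ, rfl⟩)
    · exact h.elim
    all_goals refine key ?_
    · exact (Forces.self _).of_neg_neg
    · exact Forces.mul (.of_le inf_le_left) (.of_le inf_le_right) le_rfl
    · exact .of_le (IsFLew.le_one _)
    · exact .of_le (IsFLew.zero_le _)

theorem hasGlivenkoProperty_pseudoComplLogic : pseudoComplLogic.HasGlivenkoProperty CPL := by
  intro φ
  have := isPseudoCompl_of_inVariety le_rfl (inVariety_lind pseudoComplLogic)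
  refine ⟨fun h => thm_of_forall fun e => one_le_neg_neg_of_thm_CPL h e, fun h => ?_⟩
  refine thm_of_forall fun e => ?_
  have h₁ := inVariety_lind CPL _ (pseudoComplLogic_le_CPL _ _ h) e
  have h₂ := inVariety_lind CPL _ (thm_extend _ rfl) fun _ => φ.eval e
  exact h₁.trans (one_le_himp.1 h₂)

theorem glivenko_FLew_CPL : glivenko FLew CPL = pseudoComplLogic := by
  apply le_antisymm
  · exact sup_le (sInf_le hasGlivenkoProperty_pseudoComplLogic) (le_extend _ _)
  · refine extend_le le_sup_right ?_
    rintro _ rfl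
    have h : FLe.extend {((Term.var 0).meet (Term.var 0).neg).imp Term.zero} ≤ glivenkoFLe CPL := by
      refine le_sInf fun K hK => extend_le (FLe_le K) ?_
      rintro _ rfl
      -- `K` need not have weakening: it proves `¬¬¬(p ∧ ¬p)` by the Glivenko property, and triple
      -- negation collapses in every FLe-algebra.
      have h := (hK _).1 (pseudoComplLogic_le_CPL _ _ (thm_extend _ rfl))
      refine thm_of_forall fun e => ?_
      have h₁ := inVariety_lind K _ h e
      exact h₁.trans (neg_neg_neg _).le
    exact le_sup_left (b := FLew) _ _ (h _ _ (thm_extend _ rfl))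

theorem isLeast_glivenko_FLew_CPL :
    IsLeast {K : SubstructuralLogic | FLew ≤ K ∧ K.HasGlivenkoProperty CPL}
      (glivenko FLew CPL) := by
  refine ⟨⟨le_sup_right, ?_⟩, fun K hK => sup_le (sInf_le hK.2) hK.1⟩
  rw [glivenko_FLew_CPL]
  exact hasGlivenkoProperty_pseudoComplLogic

end SubstructuralLogic

/-! ### Connexivity and Aristotle's theses -/

open SubstructuralLogic

theorem BinTerm.eval_app (t : BinTerm) {A : Type u} [FLeAlgebra A] (e : ℕ → A) (φ ψ : Fm) :
    (t.app φ ψ).eval e = t.op (φ.eval e) (ψ.eval e) := by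
  rw [BinTerm.app, eval_subst, BinTerm.op]
  congr 1
  ext i
  fin_cases i <;> rfl

theorem BinTerm.op_uLift (t : BinTerm) {A : Type u} [FLeAlgebra A] (x y : ULift.{v} A) :
    t.op x y = ⟨t.op x.down y.down⟩ := by
  rw [BinTerm.op, eval_uLift, BinTerm.op]
  congr 2
  ext i
  fin_cases i <;> rfl

/-- In a Boolean algebra the connective is the symmetric biconditional, so a non-classical algebra
is needed. Taking it in the variety of IPL serves all logics below IPL at once. -/
theorem exists_isConnexiveOp {t : BinTerm}
    (ht : t ∈ ({BinTerm.cnxFusion, BinTerm.cnxMeet} : Set BinTerm)) :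
    ∃ (A : Type u) (_ : FLeAlgebra A), InVariety IPL.1 A ∧ IsConnexiveOp (t.op (A := A)) := by
  refine ⟨ULift.{u} (OfHeyting (Fin 3)), inferInstance, (inVariety_IPL_ofHeyting _).uLift, ?_⟩
  have hr := isBicondOp_of_mem ht (ULift.{u} (OfHeyting (Fin 3)))
  refine { hr.isProtoConnexiveOp with nonsymm := ?_ }
  -- The middle element of the chain; the monoid unit is the top. As `x` is dense, `r x 1` is above
  -- the unit, while `r 1 x` is below `1 ⇨ x`, which is not.
  let x : ULift.{u} (OfHeyting (Fin 3)) := ⟨(1 : Fin 3)⟩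
  have hx : x ≤ 1 := IsFLew.le_one x
  have hx' : (1 : ULift.{u} (OfHeyting (Fin 3))) ≤ neg (neg x) := by
    refine one_le_neg.2 ?_
    change (1 : Fin 3) ⇨ (⊥ : Fin 3) ≤ ⊥
    decide
  refine ⟨x, 1, Or.inl fun h => ?_⟩
  have h₁ : 1 ≤ x := one_le_himp.1 (((hr.one_le hx hx').trans h).trans (hr.le_left _ _))
  have h₂ : (⊤ : Fin 3) ≤ 1 := h₁
  exact absurd h₂ (by decide)

end CnxLogic

theorem mainTheorem7 :
    -- the Glivenko logic of FLew relative to CPL is the least extension of FLew with the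
    -- Glivenko property, and it is FLew plus pseudo-complementation
    (IsLeast {K : SubstructuralLogic |
        SubstructuralLogic.FLew ≤ K ∧ K.HasGlivenkoProperty SubstructuralLogic.CPL}
      (SubstructuralLogic.glivenko SubstructuralLogic.FLew SubstructuralLogic.CPL) ∧
    SubstructuralLogic.glivenko SubstructuralLogic.FLew SubstructuralLogic.CPL =
      SubstructuralLogic.FLew.extend
        {((Term.var 0).meet (Term.var 0).neg).imp Term.zero}) ∧
    ∀ (L : SubstructuralLogic), SubstructuralLogic.FLew ≤ L → L ≤ SubstructuralLogic.IPL →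
      ∀ t ∈ ({BinTerm.cnxFusion, BinTerm.cnxMeet} : Set BinTerm),
        List.TFAE
          [IsConnexive.{u} L t,
           ∀ φ : Fm, L.1.Thm (t.app φ φ.neg).neg,
           ∀ φ : Fm, L.1.Thm (t.app φ.neg φ).neg,
           L.1.IsAxiomaticExtension
             (SubstructuralLogic.glivenko SubstructuralLogic.FLew SubstructuralLogic.CPL).1] := by
  refine ⟨⟨SubstructuralLogic.isLeast_glivenko_FLew_CPL, SubstructuralLogic.glivenko_FLew_CPL⟩, ?_⟩
  intro L hL hL' t ht
  rw [SubstructuralLogic.isAxiomaticExtension_iff_le, SubstructuralLogic.glivenko_FLew_CPL]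
  have hLind := L.inVariety_lind
  have := SubstructuralLogic.isFLew_of_inVariety hL hLind
  have hr := isBicondOp_of_mem ht L.Lind
  tfae_have 1 → 2 := fun h φ => SubstructuralLogic.thm_of_forall fun e => by
    -- The Lindenbaum algebra lives in `Type`, so it is lifted to the universe over which
    -- connexivity quantifies.
    have := (h.1 _ hLind.uLift).at₁ ⟨φ.eval e⟩
    rw [BinTerm.op_uLift] at this
    rw [eval_neg, BinTerm.eval_app]
    exact this
  tfae_have 1 → 3 := fun h φ => SubstructuralLogic.thm_of_forall fun e => by
    have := (h.1 _ hLind.uLift).at₂ ⟨φ.eval e⟩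
    rw [BinTerm.op_uLift] at this
    rw [eval_neg, BinTerm.eval_app]
    exact this
  tfae_have 2 → 4 := fun h => SubstructuralLogic.pseudoComplLogic_le hL <|
    hr.inf_neg_le_of_at₁ fun x => by
      simpa [BinTerm.eval_app, Term.eval] using hLind _ (h (.var 0)) fun _ => x
  tfae_have 3 → 4 := fun h => SubstructuralLogic.pseudoComplLogic_le hL <|
    hr.inf_neg_le_of_at₂ fun x => by
      simpa [BinTerm.eval_app, Term.eval] using hLind _ (h (.var 0)) fun _ => x
  tfae_have 4 → 1 := by
    refine fun h => ⟨fun A _ hA => ?_, ?_⟩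
    · have := SubstructuralLogic.isPseudoCompl_of_inVariety h hA
      exact (isBicondOp_of_mem ht A).isProtoConnexiveOp
    -- The bound `L ≤ IPL` enters here, placing the witness of asymmetry in the variety of `L`.
    · obtain ⟨A, i, hA, hc⟩ := exists_isConnexiveOp ht
      exact ⟨A, i, hA.mono hL', hc⟩
  tfae_finish
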